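/- Let $G$ be a locally compact group with a fixed left Haar measure $\mu$, let $\lambda$ be the left regular representation of $G$ on $L^2(G)$, $(\lambda(x)f)(y)=f(x^{-1}y)$, and let $VN(G)\subseteq\mathcal B(L^2(G))$ be the closure of $\operatorname{span}\{\lambda(x):x\in G\}$ in the weak operator topology. Let $A(G)$ be the set of all functions $\lambda_{f,g}(x)=\langle\lambda(x)f\,|\,g\rangle$ with $f,g\in L^2(G)$ (inner products are conjugate-linear in the second variable), paired with $VN(G)$ by $\langle\lambda_{f,g},T\rangle=\langle Tf\,|\,g\rangle$, which is well defined. For a function $v$ on $G$ put $\check v(x)=v(x^{-1})$ and $(\delta_x*v)(y)=v(x^{-1}y)$; for $T\in VN(G)$ and $v\in A(G)$ put $Tv(x)=\langle\delta_x*\check v,T\rangle$. (1) Let $E\subseteq G$ be uniformly discrete, that is, there is a neighbourhood $\mathcal U$ of the identity $e$ such that $g_1\mathcal U\cap g_2\mathcal U=\emptyset$ for all $g_1\neq g_2$ in $E$. Let $\mathcal U$ be such a neighbourhood, let $\mathcal V$ be a measurable symmetric neighbourhood of $e$ of finite Haar measure (for instance a relatively compact one) with $\mathcal V^2\subseteq\mathcal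 U$, and put $\xi=1_{\mathcal V}/\|1_{\mathcal V}\|_2$ and $u(x)=\langle\lambda(x)\xi\,|\,\xi\rangle$. Let $n\in\mathbb N$ and $[T_{ij}]\in M_n(VN(G))$, with norm that of an operator on $L^2(G)^n$; the norm of a scalar matrix is its operator norm on $\mathbb C^n$. Then the following series converges in $M_n(\mathbb C)$ and $$\Big\|\sum_{h\in E}[T_{ij}\check u(h)]^*[T_{ij}\check u(h)]\Big\|^{1/2}\le\|[T_{ij}]\|_{M_n(VN(G))}.$$ If furthermore $u(h^{-1}xh)=u(x)$ for all $x\in G$ and $h\in E$, then $\sum_{h\in E}[T_{ij}\check u(h)][T_{ij}\check u(h)]^*$ converges as well and $$\max\Big\{\Big\|\sum_{h\in E}[T_{ij}\check u(h)]^*[T_{ij}\check u(h)]\Big\|^{1/2},\ \Big\|\sum_{h\in E}[T_{ij}\check u(h)][T_{ij}\check u(h)]^*\Big\|^{1/2}\Big\}\le\|[T_{ij}]\|_{M_n(VN(G))}.$$ (2) Let $G$ be discrete and let $E\subseteq G$ be any subset. Then for every Hilbert space $\mathcal H$ and every finitely supported function $a:E\to\mathcal B(\mathcal H)$, $$\max\Big\{\Big\|\sum_{h\in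 E}a(h)^*a(h)\Big\|^{1/2},\ \Big\|\sum_{h\in E}a(h)a(h)^*\Big\|^{1/2}\Big\}\le\Big\|\sum_{h\in E}a(h)\otimes\lambda(h)\Big\|_{\mathcal B(\mathcal H)\otimes_{\min}VN(G)}.$$ -/

import Mathlib

open MeasureTheory Topology
open scoped Pointwise ENNReal TensorProduct Matrix Matrix.Norms.L2Operator

noncomputable section

namespace FourierVN

section Sets

variable {G : Type*} [Group G] [TopologicalSpace G]

/-- `U` is a neighbourhood of the identity whose left translates by distinct points of `E` are
disjoint. -/
def IsSeparatingNhd (E U : Set G) : Prop :=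
  U ∈ 𝓝 (1 : G) ∧ ∀ g₁ ∈ E, ∀ g₂ ∈ E, g₁ ≠ g₂ → Disjoint (g₁ • U) (g₂ • U)

/-- Uniformly discrete subsets of a topological group. -/
def IsUniformlyDiscrete (E : Set G) : Prop :=
  ∃ U : Set G, IsSeparatingNhd E U

/-- `check v x = v (x⁻¹)`. -/
def check (v : G → ℂ) : G → ℂ := fun x => v x⁻¹

/-- `δ_x * v`, the left translate `y ↦ v (x⁻¹ y)`. -/
def leftTranslate (x : G) (v : G → ℂ) : G → ℂ := fun y => v (x⁻¹ * y)

end Sets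

section Group

variable {G : Type*} [Group G] [TopologicalSpace G] [IsTopologicalGroup G]
  [MeasurableSpace G] [BorelSpace G] (μ : Measure G) [μ.IsMulLeftInvariant]

/-- The Hilbert space `L²(G)`. -/
abbrev L2 {G : Type*} [MeasurableSpace G] (μ : Measure G) : Type _ := Lp ℂ 2 μ

/-- The left regular representation, `(λ(x) f)(y) = f (x⁻¹ y)`. -/
def leftReg (x : G) : L2 μ →L[ℂ] L2 μ :=
  (Lp.compMeasurePreservingₗᵢ ℂ (fun y : G => x⁻¹ * y)
    (measurePreserving_mul_left μ x⁻¹)).toContinuousLinearMap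

/-- The coefficient function `x ↦ ⟨λ(x) f | g⟩` of the left regular representation. (Mathlib's
inner product is conjugate-linear in its first argument.) The Fourier algebra `A(G)` is the set
of all these functions. -/
def coeff (f g : L2 μ) : G → ℂ := fun x => inner ℂ g (leftReg μ x f)

/-- The group von Neumann algebra `VN(G)`: the closure of the linear span of the left
translations in the weak operator topology of `B(L²(G))`. -/
def VN : Set (L2 μ →L[ℂ] L2 μ) :=
  {T | ContinuousLinearMapWOT.ofCLM T ∈
    closure (ContinuousLinearMapWOT.ofCLM ''
      (Submodule.span ℂ (Set.range (leftReg μ)) : Set (L2 μ →L[ℂ] L2 μ)))}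

open Classical in
/-- The duality `⟨w, T⟩ = ⟨T f | g⟩` between `w ∈ A(G)`, `w = coeff μ f g`, and `T ∈ VN(G)`
(and `0` if `w ∉ A(G)`). By `pairing_coeff` it does not depend on the choice of `f` and `g`. -/
def pairing (w : G → ℂ) (T : L2 μ →L[ℂ] L2 μ) : ℂ :=
  if hw : ∃ p : L2 μ × L2 μ, w = coeff μ p.1 p.2 then
    inner ℂ hw.choose.2 (T hw.choose.1)
  else 0

lemma inner_eq_of_coeff_eq {f g f' g' : L2 μ} (h : coeff μ f g = coeff μ f' g')
    {T : L2 μ →L[ℂ] L2 μ} (hT : T ∈ VN μ) : inner ℂ g (T f) = inner ℂ g' (T f') := by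
  have hc : IsClosed {A : L2 μ →WOT[ℂ] L2 μ | innerSL ℂ g (A f) = innerSL ℂ g' (A f')} :=
    isClosed_eq (ContinuousLinearMapWOT.continuous_dual_apply f (innerSL ℂ g))
      (ContinuousLinearMapWOT.continuous_dual_apply f' (innerSL ℂ g'))
  have hsub : ContinuousLinearMapWOT.ofCLM ''
      (Submodule.span ℂ (Set.range (leftReg μ)) : Set (L2 μ →L[ℂ] L2 μ)) ⊆
      {A : L2 μ →WOT[ℂ] L2 μ | innerSL ℂ g (A f) = innerSL ℂ g' (A f')} := by
    rintro _ ⟨S, hS, rfl⟩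
    show inner ℂ g (S f) = inner ℂ g' (S f')
    induction hS using Submodule.span_induction with
    | mem S hS =>
      obtain ⟨x, rfl⟩ := hS
      exact congrFun h x
    | zero => simp
    | add S S' _ _ h1 h2 => simp [inner_add_right, h1, h2]
    | smul c S _ h1 => simp [inner_smul_right, h1]
  exact closure_minimal hsub hc hT

lemma pairing_coeff (f g : L2 μ) {T : L2 μ →L[ℂ] L2 μ} (hT : T ∈ VN μ) :
    pairing μ (coeff μ f g) T = inner ℂ g (T f) := by
  have hw : ∃ p : L2 μ × L2 μ, coeff μ f g = coeff μ p.1 p.2 := ⟨(f, g), rfl⟩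
  rw [pairing, dif_pos hw]
  exact inner_eq_of_coeff_eq μ hw.choose_spec.symm hT

/-- The action of `T ∈ VN(G)` on `v ∈ A(G)`: `(T v)(x) = ⟨δ_x * check v, T⟩`. -/
def action (T : L2 μ →L[ℂ] L2 μ) (v : G → ℂ) : G → ℂ :=
  fun x => pairing μ (leftTranslate x (check v)) T

/-- The unit vector `1_V / ‖1_V‖₂` of `L²(G)`. -/
def normalizedIndicator {V : Set G} (hV : MeasurableSet V) (hμV : μ V ≠ ∞) : L2 μ :=
  ((‖indicatorConstLp 2 hV hμV (1 : ℂ)‖⁻¹ : ℝ) : ℂ) • indicatorConstLp 2 hV hμV (1 : ℂ)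

/-- The functions `u = ⟨λ(·) ξ | ξ⟩`, `ξ = 1_V / ‖1_V‖₂`, attached to `E`: here `V` is a symmetric
neighbourhood of the identity with `V V ⊆ U`, and `U` is a neighbourhood of the identity whose
translates by distinct points of `E` are disjoint. -/
def IsAttachedFunction (E : Set G) (u : G → ℂ) : Prop :=
  ∃ (U V : Set G) (hV : MeasurableSet V) (hμV : μ V ≠ ∞),
    IsSeparatingNhd E U ∧ V ∈ 𝓝 (1 : G) ∧ V⁻¹ = V ∧ V * V ⊆ U ∧
      u = coeff μ (normalizedIndicator μ hV hμV) (normalizedIndicator μ hV hμV)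

/-- The scalar matrix `[T_ij v (h)]`. -/
def actionMatrix {n : ℕ} (T : Matrix (Fin n) (Fin n) (L2 μ →L[ℂ] L2 μ)) (v : G → ℂ) (h : G) :
    Matrix (Fin n) (Fin n) ℂ :=
  Matrix.of fun i j => action μ (T i j) v h

end Group

/-- A matrix of operators on a Hilbert space `K` as an operator on the Hilbert space `Kⁿ`; the norm
of `M_n(B(K))`, hence of `M_n(VN(G))`, is the operator norm of this operator. -/
def matrixOperator {K : Type*} [NormedAddCommGroup K] [InnerProductSpace ℂ K] {n : ℕ}
    (T : Matrix (Fin n) (Fin n) (K →L[ℂ] K)) :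
    PiLp 2 (fun _ : Fin n => K) →L[ℂ] PiLp 2 (fun _ : Fin n => K) :=
  (PiLp.continuousLinearEquiv 2 ℂ (fun _ : Fin n => K)).symm.toContinuousLinearMap ∘L
    ContinuousLinearMap.pi fun i => ∑ j, T i j ∘L PiLp.proj 2 (fun _ : Fin n => K) j

lemma matrixOperator_apply {K : Type*} [NormedAddCommGroup K] [InnerProductSpace ℂ K] {n : ℕ}
    (T : Matrix (Fin n) (Fin n) (K →L[ℂ] K)) (x : PiLp 2 (fun _ : Fin n => K)) (i : Fin n) :
    matrixOperator T x i = ∑ j, T i j (x j) := by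
  simp [matrixOperator]

end FourierVN

end

/-! Both parts are Bessel's inequality for an orbit of the regular representation. Translating `u`
by `h` moves `λ(h)` onto the second vector of the coefficient, so `T ǔ(h)` is the Fourier
coefficient of `T ξ` along `λ(h) ξ` (`action_check_coeff`). These vectors are orthonormal, because
their supports `hV` are disjoint. Bessel in each coordinate of `[T_ij](x ⊗ ξ)` bounds the column
(`sum_norm_sq_bessel_le`), and this controls the sum of the `A* A`
(`summable_and_sqrt_norm_tsum_le`).

For the row, conjugation invariance moves the translation onto the first vector, which turns the
conjugate transposes into coefficients of the adjoint matrix along `λ(h⁻¹) ξ`.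

In the discrete case `ξ` is the point mass at `1`: evaluating `∑ a(h) ⊗ λ(h)` at `x ⊗ ξ` gives the
column, and adjoints give the row. -/

noncomputable section

namespace FourierVN

/-! ### Column bounds and Bessel's inequality for operator matrices -/

section Operators

variable {K : Type*} [NormedAddCommGroup K] [InnerProductSpace ℂ K]

/-- A family of operators whose column is bounded by `C` satisfies `‖∑ aᵢ* aᵢ‖^{1/2} ≤ C`. -/
lemma sqrt_norm_sum_adjoint_mul_le [CompleteSpace K] {ι : Type*} (s : Finset ι) (a : ι → K →L[ℂ] K)
    {C : ℝ} (hC : 0 ≤ C) (h : ∀ x, ∑ i ∈ s, ‖a i x‖ ^ 2 ≤ (C * ‖x‖) ^ 2) :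
    √‖∑ i ∈ s, ContinuousLinearMap.adjoint (a i) * a i‖ ≤ C := by
  refine Real.sqrt_le_iff.2 ⟨hC, ContinuousLinearMap.opNorm_le_of_re_inner_le (by positivity) ?_⟩
  intro x y hx hy
  have hin : inner ℂ ((∑ i ∈ s, ContinuousLinearMap.adjoint (a i) * a i) x) y =
      ∑ i ∈ s, inner ℂ (a i x) (a i y) := by
    simp [ContinuousLinearMap.adjoint_inner_left]
  calc RCLike.re (inner ℂ ((∑ i ∈ s, ContinuousLinearMap.adjoint (a i) * a i) x) y)
      ≤ ‖∑ i ∈ s, inner ℂ (a i x) (a i y)‖ := by rw [hin]; exact RCLike.re_le_norm _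
    _ ≤ ∑ i ∈ s, ‖a i x‖ * ‖a i y‖ :=
        (norm_sum_le _ _).trans (Finset.sum_le_sum fun i _ => norm_inner_le_norm _ _)
    _ ≤ √(∑ i ∈ s, ‖a i x‖ ^ 2) * √(∑ i ∈ s, ‖a i y‖ ^ 2) :=
        Real.sum_mul_le_sqrt_mul_sqrt _ _ _
    _ ≤ (C * ‖x‖) * (C * ‖y‖) := by
        gcongr <;> exact Real.sqrt_le_iff.2 ⟨by positivity, h _⟩
    _ = C ^ 2 := by rw [hx, hy]; ring

/-- The norm of the vector `(x₁ ξ, …, xₙ ξ)`. -/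
lemma norm_toLp_smul {n : ℕ} (x : EuclideanSpace ℂ (Fin n)) (ξ : K) :
    ‖(WithLp.toLp 2 (fun j => x j • ξ) : PiLp 2 (fun _ : Fin n => K))‖ = ‖x‖ * ‖ξ‖ := by
  rw [PiLp.norm_eq_of_L2, EuclideanSpace.norm_eq]
  simp only [norm_smul, mul_pow]
  rw [← Finset.sum_mul, Real.sqrt_mul (by positivity), Real.sqrt_sq (norm_nonneg _)]

/-- A matrix of adjoints, transposed, is bounded by the norm of the original operator matrix. -/
lemma norm_matrixOperator_adjoint_le [CompleteSpace K] {n : ℕ}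
    (T : Matrix (Fin n) (Fin n) (K →L[ℂ] K)) :
    ‖matrixOperator (Matrix.of fun i j => ContinuousLinearMap.adjoint (T j i))‖ ≤
      ‖matrixOperator T‖ := by
  have h : matrixOperator (Matrix.of fun i j => ContinuousLinearMap.adjoint (T j i)) =
      ContinuousLinearMap.adjoint (matrixOperator T) := by
    rw [ContinuousLinearMap.eq_adjoint_iff]
    intro x y
    simp only [PiLp.inner_apply, matrixOperator_apply, Matrix.of_apply, sum_inner, inner_sum,
      ContinuousLinearMap.adjoint_inner_left]
    exact Finset.sum_comm
  rw [h]
  exact (LinearIsometryEquiv.norm_map _ _).le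

/-- Bessel's inequality for the scalar matrices `[⟨T_ij ξ | v_h⟩]`. -/
lemma sum_norm_sq_bessel_le {ι : Type*} {v : ι → K} (hv : Orthonormal ℂ v) {ξ : K} (hξ : ‖ξ‖ = 1)
    {n : ℕ} (T : Matrix (Fin n) (Fin n) (K →L[ℂ] K)) (s : Finset ι)
    (x : EuclideanSpace ℂ (Fin n)) :
    ∑ h ∈ s, ‖Matrix.toEuclideanCLM (n := Fin n) (𝕜 := ℂ)
      (Matrix.of fun i j => inner ℂ (v h) (T i j ξ)) x‖ ^ 2 ≤ (‖matrixOperator T‖ * ‖x‖) ^ 2 := by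
  -- `X` plays the role of `x ⊗ ξ`; the scalar matrices applied to `x` collect the coefficients of
  -- `matrixOperator T X` along the `v h`.
  set X : PiLp 2 (fun _ : Fin n => K) := WithLp.toLp 2 (fun j => x j • ξ) with hX
  have hXn : ‖X‖ = ‖x‖ := by rw [hX, norm_toLp_smul, hξ, mul_one]
  have hcoord : ∀ h i, Matrix.toEuclideanCLM (n := Fin n) (𝕜 := ℂ)
      (Matrix.of fun i j => inner ℂ (v h) (T i j ξ)) x i = inner ℂ (v h) (matrixOperator T X i) := by
    intro h i
    rw [Matrix.ofLp_toEuclideanCLM, matrixOperator_apply]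
    simp [hX, Matrix.mulVec, dotProduct, mul_comm]
  calc _ = ∑ h ∈ s, ∑ i, ‖inner ℂ (v h) (matrixOperator T X i)‖ ^ 2 := by
        refine Finset.sum_congr rfl fun h _ => ?_
        rw [EuclideanSpace.norm_sq_eq]
        simp only [hcoord]
    _ = ∑ i, ∑ h ∈ s, ‖inner ℂ (v h) (matrixOperator T X i)‖ ^ 2 := Finset.sum_comm
    _ ≤ ∑ i, ‖matrixOperator T X i‖ ^ 2 :=
        Finset.sum_le_sum fun i _ => hv.sum_inner_products_le _
    _ = ‖matrixOperator T X‖ ^ 2 := (PiLp.norm_sq_eq_of_L2 _ _).symm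
    _ ≤ _ := by
        rw [← hXn]
        gcongr
        exact ContinuousLinearMap.le_opNorm _ _

/-- The column sum of a family of matrices with a bounded column. -/
lemma summable_and_sqrt_norm_tsum_le {ι : Type*} {n : ℕ} (A : ι → Matrix (Fin n) (Fin n) ℂ)
    {C : ℝ} (hC : 0 ≤ C)
    (h : ∀ (s : Finset ι) (x : EuclideanSpace ℂ (Fin n)),
      ∑ i ∈ s, ‖Matrix.toEuclideanCLM (n := Fin n) (𝕜 := ℂ) (A i) x‖ ^ 2 ≤ (C * ‖x‖) ^ 2) :
    Summable (fun i => (A i)ᴴ * A i) ∧ √‖∑' i, (A i)ᴴ * A i‖ ≤ C := by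
  -- Testing the column bound on basis vectors makes every entry square-summable; products of two
  -- entries are then summable by `2ab ≤ a² + b²`.
  have hentry : ∀ j k, Summable fun i => ‖A i j k‖ ^ 2 := by
    intro j k
    refine summable_of_sum_le (c := (C * ‖EuclideanSpace.single k (1 : ℂ)‖) ^ 2)
      (fun i => by positivity) fun s => ?_
    refine (Finset.sum_le_sum fun i _ => ?_).trans (h s (EuclideanSpace.single k (1 : ℂ)))
    have hjk : A i j k =
        Matrix.toEuclideanCLM (n := Fin n) (𝕜 := ℂ) (A i) (EuclideanSpace.single k 1) j := by
      rw [Matrix.ofLp_toEuclideanCLM]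
      simp
    rw [hjk]
    gcongr
    exact PiLp.norm_apply_le _ _
  have hsum : Summable (fun i => (A i)ᴴ * A i) := by
    refine Pi.summable.2 fun j => Pi.summable.2 fun k => ?_
    simp only [Matrix.mul_apply, Matrix.conjTranspose_apply]
    refine summable_sum fun l _ => Summable.of_norm_bounded ((hentry l j).add (hentry l k)) ?_
    intro i
    rw [norm_mul, norm_star]
    nlinarith [sq_nonneg (‖A i l j‖ - ‖A i l k‖), sq_nonneg ‖A i l j‖, sq_nonneg ‖A i l k‖]
  refine ⟨hsum, le_of_tendsto' ((Real.continuous_sqrt.comp continuous_norm).continuousAt.tendsto.comp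
    hsum.hasSum) fun s => ?_⟩
  have hs := sqrt_norm_sum_adjoint_mul_le s
    (fun i => Matrix.toEuclideanCLM (n := Fin n) (𝕜 := ℂ) (A i)) hC (h s)
  have hmap : Matrix.toEuclideanCLM (n := Fin n) (𝕜 := ℂ) (∑ i ∈ s, (A i)ᴴ * A i) =
      ∑ i ∈ s, ContinuousLinearMap.adjoint (Matrix.toEuclideanCLM (n := Fin n) (𝕜 := ℂ) (A i)) *
        Matrix.toEuclideanCLM (n := Fin n) (𝕜 := ℂ) (A i) := by
    simp only [map_sum, map_mul, ← Matrix.star_eq_conjTranspose, map_star,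
      ContinuousLinearMap.star_eq_adjoint]
  rw [← hmap, Matrix.l2_opNorm_toEuclideanCLM] at hs
  exact hs

end Operators

/-! ### Sums of elementary tensors of operators -/

section TensorSums

variable {H K : Type*} [NormedAddCommGroup H] [InnerProductSpace ℂ H]
  [NormedAddCommGroup K] [InnerProductSpace ℂ K]

/-- The norm of `∑ yᵢ ⊗ vᵢ` for an orthonormal family `v`. -/
lemma norm_sq_sum_tmul_orthonormal {ι : Type*} {v : ι → K} (hv : Orthonormal ℂ v) (s : Finset ι)
    (y : ι → H) : ‖∑ i ∈ s, y i ⊗ₜ[ℂ] v i‖ ^ 2 = ∑ i ∈ s, ‖y i‖ ^ 2 := by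
  classical
  have h : (inner ℂ (∑ i ∈ s, y i ⊗ₜ[ℂ] v i) (∑ i ∈ s, y i ⊗ₜ[ℂ] v i) : ℂ) =
      ∑ i ∈ s, (‖y i‖ : ℂ) ^ 2 := by
    simp only [sum_inner, inner_sum, TensorProduct.inner_tmul, orthonormal_iff_ite.1 hv]
    refine Finset.sum_congr rfl fun i hi => ?_
    simp [hi, inner_self_eq_norm_sq_to_K]
  have h' := (inner_self_eq_norm_sq_to_K (𝕜 := ℂ) (∑ i ∈ s, y i ⊗ₜ[ℂ] v i)).symm.trans h
  exact Complex.ofReal_injective (by push_cast; exact h')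

/-- At `x ⊗ ξ` the operator takes the value `∑ aᵢ x ⊗ lᵢ ξ`, whose terms are orthogonal. -/
lemma sum_norm_sq_le_norm_sum_mapL {ι : Type*} (s : Finset ι) (a : ι → H →L[ℂ] H)
    (l : ι → K →L[ℂ] K) {ξ : K} (hξ : ‖ξ‖ = 1) (hl : Orthonormal ℂ fun i => l i ξ) (x : H) :
    ∑ i ∈ s, ‖a i x‖ ^ 2 ≤ (‖∑ i ∈ s, TensorProduct.mapL (a i) (l i)‖ * ‖x‖) ^ 2 := by
  rw [← norm_sq_sum_tmul_orthonormal hl s]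
  have h : ∑ i ∈ s, a i x ⊗ₜ[ℂ] l i ξ =
      (∑ i ∈ s, TensorProduct.mapL (a i) (l i)) (x ⊗ₜ[ℂ] ξ) := by
    simp only [sum_apply, TensorProduct.mapL_tmul]
  have hx : ‖x ⊗ₜ[ℂ] ξ‖ = ‖x‖ := by rw [TensorProduct.norm_tmul, hξ, mul_one]
  rw [h, ← hx]
  gcongr
  exact ContinuousLinearMap.le_opNorm _ _

lemma inner_mapL_adjoint [CompleteSpace H] [CompleteSpace K] (a : H →L[ℂ] H) (l : K →L[ℂ] K)
    (z w : H ⊗[ℂ] K) :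
    inner ℂ (TensorProduct.mapL (ContinuousLinearMap.adjoint a) (ContinuousLinearMap.adjoint l) z) w
      = inner ℂ z (TensorProduct.mapL a l w) := by
  induction z using TensorProduct.induction_on with
  | zero => simp
  | add z₁ z₂ h₁ h₂ => rw [map_add, inner_add_left, inner_add_left, h₁, h₂]
  | tmul x y =>
    induction w using TensorProduct.induction_on with
    | zero => simp
    | add w₁ w₂ h₁ h₂ => rw [map_add, inner_add_right, inner_add_right, h₁, h₂]
    | tmul x' y' =>
      simp only [TensorProduct.mapL_tmul, TensorProduct.inner_tmul,
        ContinuousLinearMap.adjoint_inner_left]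

/-- The algebraic tensor product need not be complete, so the norms are compared through the
sesquilinear form instead of a Hilbert space adjoint. -/
lemma norm_sum_mapL_adjoint_le [CompleteSpace H] [CompleteSpace K] {ι : Type*} (s : Finset ι)
    (a : ι → H →L[ℂ] H) (l : ι → K →L[ℂ] K) :
    ‖∑ i ∈ s, TensorProduct.mapL (ContinuousLinearMap.adjoint (a i))
      (ContinuousLinearMap.adjoint (l i))‖ ≤ ‖∑ i ∈ s, TensorProduct.mapL (a i) (l i)‖ := by
  refine ContinuousLinearMap.opNorm_le_of_re_inner_le (ContinuousLinearMap.opNorm_nonneg _)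
    fun z w hz hw => ?_
  have h : inner ℂ ((∑ i ∈ s, TensorProduct.mapL (ContinuousLinearMap.adjoint (a i))
      (ContinuousLinearMap.adjoint (l i))) z) w =
      inner ℂ z ((∑ i ∈ s, TensorProduct.mapL (a i) (l i)) w) := by
    simp only [sum_apply, sum_inner, inner_sum, inner_mapL_adjoint]
  rw [h]
  refine (RCLike.re_le_norm _).trans ((norm_inner_le_norm _ _).trans ?_)
  rw [hz, one_mul]
  simpa [hw] using ContinuousLinearMap.le_opNorm (∑ i ∈ s, TensorProduct.mapL (a i) (l i)) w

end TensorSums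

/-! ### Translations in `L²(G)` and the action of `VN(G)` on coefficients -/

section Group

lemma norm_normalizedIndicator {G : Type*} [MeasurableSpace G] (μ : Measure G) {V : Set G} (hV : MeasurableSet V) (hμV : μ V ≠ ∞)
    (h0 : μ V ≠ 0) : ‖normalizedIndicator μ hV hμV‖ = 1 := by
  have hne : ‖indicatorConstLp 2 hV hμV (1 : ℂ)‖ ≠ 0 := by
    rw [norm_indicatorConstLp two_ne_zero ENNReal.ofNat_ne_top]
    have : 0 < μ.real V := ENNReal.toReal_pos h0 hμV
    simp only [norm_one, one_mul]
    positivity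
  rw [normalizedIndicator, norm_smul]
  simp [hne]

lemma check_check {G : Type*} [Group G] (v : G → ℂ) : check (check v) = v := by
  funext x
  simp [check]

variable {G : Type*} [Group G] [TopologicalSpace G] [IsTopologicalGroup G]
  [MeasurableSpace G] [BorelSpace G] (μ : Measure G) [μ.IsMulLeftInvariant]

lemma leftReg_mul (x y : G) (f : L2 μ) : leftReg μ (x * y) f = leftReg μ x (leftReg μ y f) := by
  have h := Lp.compMeasurePreserving_comp_apply f (measurePreserving_mul_left μ y⁻¹)
    (measurePreserving_mul_left μ x⁻¹)
  have hfun : (fun z : G => (x * y)⁻¹ * z) = (fun z => y⁻¹ * z) ∘ fun z => x⁻¹ * z := by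
    funext z
    simp [mul_assoc]
  refine Eq.trans ?_ h
  simp only [leftReg]
  change Lp.compMeasurePreserving (fun z : G => (x * y)⁻¹ * z) _ f = _
  congr 1
  simp only [hfun]

lemma leftReg_one (f : L2 μ) : leftReg μ 1 f = f := by
  refine Eq.trans ?_ (Lp.compMeasurePreserving_id_apply (E := ℂ) (p := 2) f)
  change Lp.compMeasurePreserving (fun z : G => 1⁻¹ * z) _ f = _
  congr 1
  simp only [inv_one, one_mul]
  rfl

lemma norm_leftReg (x : G) (f : L2 μ) : ‖leftReg μ x f‖ = ‖f‖ :=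
  LinearIsometry.norm_map _ _

lemma inner_leftReg_leftReg (x : G) (f g : L2 μ) :
    inner ℂ (leftReg μ x f) (leftReg μ x g) = inner ℂ f g :=
  LinearIsometry.inner_map_map _ _ _

lemma inner_leftReg_right (x : G) (f g : L2 μ) :
    inner ℂ f (leftReg μ x g) = inner ℂ (leftReg μ x⁻¹ f) g := by
  rw [← inner_leftReg_leftReg μ x (leftReg μ x⁻¹ f), ← leftReg_mul, mul_inv_cancel, leftReg_one]

lemma adjoint_leftReg (x : G) : ContinuousLinearMap.adjoint (leftReg μ x) = leftReg μ x⁻¹ := by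
  symm
  rw [ContinuousLinearMap.eq_adjoint_iff]
  intro f g
  exact (inner_leftReg_right μ x f g).symm

/-- Left translations by distinct points carry the indicator of a set with disjoint translates
to orthogonal vectors. -/
lemma inner_leftReg_normalizedIndicator_eq_zero {V : Set G} (hV : MeasurableSet V)
    (hμV : μ V ≠ ∞) {x y : G} (h : Disjoint (x • V) (y • V)) :
    inner ℂ (leftReg μ x (normalizedIndicator μ hV hμV))
      (leftReg μ y (normalizedIndicator μ hV hμV)) = 0 := by
  have hind : ∀ z : G, leftReg μ z (indicatorConstLp 2 hV hμV (1 : ℂ)) =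
      indicatorConstLp 2 ((measurePreserving_mul_left μ z⁻¹).measurable hV)
        (by rwa [(measurePreserving_mul_left μ z⁻¹).measure_preimage hV.nullMeasurableSet])
        (1 : ℂ) := fun z =>
    (Lp.indicatorConstLp_compMeasurePreserving hV hμV (1 : ℂ)
      (measurePreserving_mul_left μ z⁻¹)).symm
  have hpre : ∀ z : G, (fun w => z⁻¹ * w) ⁻¹' V = z • V := fun z => by
    ext w
    simp [Set.mem_smul_set_iff_inv_smul_mem]
  simp only [normalizedIndicator, map_smul, hind, inner_smul_left, inner_smul_right,
    L2.inner_indicatorConstLp_one_indicatorConstLp_one, hpre, h.inter_eq]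
  simp

lemma orthonormal_leftReg {ι : Type*} {V : Set G} (hV : MeasurableSet V) (hμV : μ V ≠ ∞)
    (h0 : μ V ≠ 0) (p : ι → G) (hp : Pairwise fun i j => Disjoint (p i • V) (p j • V)) :
    Orthonormal ℂ fun i => leftReg μ (p i) (normalizedIndicator μ hV hμV) :=
  ⟨fun _ => (norm_leftReg μ _ _).trans (norm_normalizedIndicator μ hV hμV h0), fun _ _ hij =>
    inner_leftReg_normalizedIndicator_eq_zero μ hV hμV (hp hij)⟩

lemma leftTranslate_coeff (x : G) (f g : L2 μ) :
    leftTranslate x (coeff μ f g) = coeff μ f (leftReg μ x g) := by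
  funext y
  simp only [leftTranslate, coeff, leftReg_mul]
  rw [inner_leftReg_right, inv_inv]

lemma action_check_coeff {T : L2 μ →L[ℂ] L2 μ} (hT : T ∈ VN μ) (f g : L2 μ) (x : G) :
    action μ T (check (coeff μ f g)) x = inner ℂ (leftReg μ x g) (T f) := by
  rw [action, check_check, leftTranslate_coeff, pairing_coeff μ _ _ hT]

/-- If `⟨λ(·) f | g⟩` is invariant under conjugation by `x`, then its left translate by `x` is also
a right translate. -/
lemma action_check_coeff_of_conj_invariant {T : L2 μ →L[ℂ] L2 μ} (hT : T ∈ VN μ) (f g : L2 μ)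
    {x : G} (hx : ∀ y, coeff μ f g (x⁻¹ * y * x) = coeff μ f g y) :
    action μ T (check (coeff μ f g)) x = inner ℂ g (T (leftReg μ x⁻¹ f)) := by
  -- Invariance at `y x⁻¹` says that the values at `x⁻¹ y` and `y x⁻¹` agree.
  have h : leftTranslate x (coeff μ f g) = coeff μ (leftReg μ x⁻¹ f) g := by
    funext y
    rw [leftTranslate, ← mul_inv_cancel_right (x⁻¹ * y) x⁻¹, inv_inv, ← mul_inv_cancel_right y x⁻¹,
      ← mul_assoc]
    have := hx (y * x⁻¹)
    simp only [mul_assoc, inv_mul_cancel, mul_one, inv_inv] at this ⊢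
    rw [this]
    simp only [coeff, leftReg_mul]
  rw [action, check_check, h, pairing_coeff μ _ _ hT]

end Group

/-! ### Row and column bounds -/

section Main

variable {G : Type*} [Group G] [TopologicalSpace G] [IsTopologicalGroup G]
  [MeasurableSpace G] [BorelSpace G] (μ : Measure G) [μ.IsMulLeftInvariant]

/-- The column sum, for a function attached to a set `V` whose translates by `E` are disjoint. -/
lemma column_bound {E V : Set G} (hV : MeasurableSet V) (hμV : μ V ≠ ∞) (h0 : μ V ≠ 0)
    (hE : Pairwise fun h k : E => Disjoint ((h : G) • V) ((k : G) • V)) {n : ℕ}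
    (T : Matrix (Fin n) (Fin n) (L2 μ →L[ℂ] L2 μ)) (hT : ∀ i j, T i j ∈ VN μ) {u : G → ℂ}
    (hu : u = coeff μ (normalizedIndicator μ hV hμV) (normalizedIndicator μ hV hμV)) :
    Summable (fun h : E => (actionMatrix μ T (check u) h)ᴴ * actionMatrix μ T (check u) h) ∧
      √‖∑' h : E, (actionMatrix μ T (check u) h)ᴴ * actionMatrix μ T (check u) h‖
        ≤ ‖matrixOperator T‖ := by
  subst hu
  refine summable_and_sqrt_norm_tsum_le
    (fun h : E => actionMatrix μ T (check (coeff μ _ _)) h) (norm_nonneg _) fun s x => ?_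
  have h := sum_norm_sq_bessel_le (orthonormal_leftReg μ hV hμV h0 (fun h : E => (h : G)) hE)
    (norm_normalizedIndicator μ hV hμV h0) T s x
  simpa only [actionMatrix, action_check_coeff μ (hT _ _)] using h

/-- The row sum, when in addition the function is invariant under conjugation by `E`. -/
lemma row_bound {E V : Set G} (hV : MeasurableSet V) (hμV : μ V ≠ ∞) (h0 : μ V ≠ 0)
    (hE : Pairwise fun h k : E => Disjoint ((h : G) • V) ((k : G) • V)) {n : ℕ}
    (T : Matrix (Fin n) (Fin n) (L2 μ →L[ℂ] L2 μ)) (hT : ∀ i j, T i j ∈ VN μ) {u : G → ℂ}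
    (hu : u = coeff μ (normalizedIndicator μ hV hμV) (normalizedIndicator μ hV hμV))
    (hconj : ∀ x : G, ∀ h ∈ E, u (h⁻¹ * x * h) = u x) :
    Summable (fun h : E => actionMatrix μ T (check u) h * (actionMatrix μ T (check u) h)ᴴ) ∧
      √‖∑' h : E, actionMatrix μ T (check u) h * (actionMatrix μ T (check u) h)ᴴ‖
        ≤ ‖matrixOperator T‖ := by
  subst hu
  set ξ := normalizedIndicator μ hV hμV
  have hξ : ‖ξ‖ = 1 := norm_normalizedIndicator μ hV hμV h0
  -- The sets `h⁻¹V` are not assumed disjoint. Orthogonality comes from invariance: `u(h k⁻¹) =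
  -- u(k⁻¹ h)`, and the latter is an inner product of `λ(h) ξ` and `λ(k) ξ`.
  have hon : Orthonormal ℂ fun h : E => leftReg μ (h : G)⁻¹ ξ := by
    refine ⟨fun h => (norm_leftReg μ _ _).trans hξ, fun h k hhk => ?_⟩
    have h1 : coeff μ ξ ξ ((k : G)⁻¹ * h) = coeff μ ξ ξ ((h : G) * (k : G)⁻¹) := by
      simpa using hconj ((h : G) * (k : G)⁻¹) h h.2
    simp only [coeff, leftReg_mul] at h1
    rw [inner_leftReg_right μ (k : G)⁻¹ ξ (leftReg μ (h : G) ξ), inv_inv,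
      inner_leftReg_right μ (h : G) ξ (leftReg μ (k : G)⁻¹ ξ)] at h1
    exact h1.symm.trans (inner_leftReg_normalizedIndicator_eq_zero μ hV hμV (hE hhk.symm))
  have h := summable_and_sqrt_norm_tsum_le
    (fun h : E => (actionMatrix μ T (check (coeff μ ξ ξ)) h)ᴴ) (norm_nonneg (matrixOperator T))
    fun s x => ?_
  · simpa only [Matrix.conjTranspose_conjTranspose] using h
  have hb := sum_norm_sq_bessel_le hon hξ
    (Matrix.of fun i j => ContinuousLinearMap.adjoint (T j i)) s x
  have hmat : ∀ h : E, (actionMatrix μ T (check (coeff μ ξ ξ)) h)ᴴ = Matrix.of fun i j =>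
      inner ℂ (leftReg μ (h : G)⁻¹ ξ)
        ((Matrix.of fun i j => ContinuousLinearMap.adjoint (T j i)) i j ξ) := by
    intro h
    ext i j
    simp only [actionMatrix, Matrix.conjTranspose_apply, Matrix.of_apply,
      action_check_coeff_of_conj_invariant μ (hT _ _) ξ ξ fun y => hconj y h h.2,
      ContinuousLinearMap.adjoint_inner_right]
    exact inner_conj_symm _ _
  simp only [hmat]
  refine hb.trans ?_
  gcongr
  exact norm_matrixOperator_adjoint_le T

/-- The row and column bounds for finitely many left translations of a vector `ξ` along which both
`λ(·) ξ` and `λ(·)⁻¹ ξ` are orthonormal. -/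
lemma row_column_le_norm_sum_mapL {H K : Type*} [NormedAddCommGroup H] [InnerProductSpace ℂ H]
    [CompleteSpace H] [NormedAddCommGroup K] [InnerProductSpace ℂ K] [CompleteSpace K]
    {ι : Type*} (s : Finset ι) (a : ι → H →L[ℂ] H) (l : ι → K →L[ℂ] K) {ξ : K} (hξ : ‖ξ‖ = 1)
    (hl : Orthonormal ℂ fun i => l i ξ)
    (hl' : Orthonormal ℂ fun i => ContinuousLinearMap.adjoint (l i) ξ) :
    max (√‖∑ i ∈ s, ContinuousLinearMap.adjoint (a i) * a i‖)
        (√‖∑ i ∈ s, a i * ContinuousLinearMap.adjoint (a i)‖)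
      ≤ ‖∑ i ∈ s, TensorProduct.mapL (a i) (l i)‖ := by
  refine max_le (sqrt_norm_sum_adjoint_mul_le s a (ContinuousLinearMap.opNorm_nonneg _)
    (sum_norm_sq_le_norm_sum_mapL s a l hξ hl)) ?_
  have h := sqrt_norm_sum_adjoint_mul_le s (fun i => ContinuousLinearMap.adjoint (a i))
    (ContinuousLinearMap.opNorm_nonneg _) (sum_norm_sq_le_norm_sum_mapL s _ _ hξ hl')
  simp only [ContinuousLinearMap.adjoint_adjoint] at h
  exact h.trans (norm_sum_mapL_adjoint_le s a l)

end Main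

end FourierVN

end

open FourierVN in
theorem corollary3p2 {G : Type*} [Group G] [TopologicalSpace G] [IsTopologicalGroup G]
    [LocallyCompactSpace G] [MeasurableSpace G] [BorelSpace G]
    (μ : Measure G) [μ.IsHaarMeasure] [μ.Regular] (E : Set G)
    {H : Type*} [NormedAddCommGroup H] [InnerProductSpace ℂ H] [CompleteSpace H] :
    -- the bounds for a uniformly discrete set in a locally compact group
    (IsUniformlyDiscrete E → ∀ u : G → ℂ, IsAttachedFunction μ E u →
      ∀ (n : ℕ) (T : Matrix (Fin n) (Fin n) (L2 μ →L[ℂ] L2 μ)), (∀ i j, T i j ∈ VN μ) →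
        (Summable (fun h : E =>
            (actionMatrix μ T (check u) h)ᴴ * actionMatrix μ T (check u) h) ∧
          √‖∑' h : E, (actionMatrix μ T (check u) h)ᴴ * actionMatrix μ T (check u) h‖
            ≤ ‖matrixOperator T‖) ∧
        ((∀ x : G, ∀ h ∈ E, u (h⁻¹ * x * h) = u x) →
          Summable (fun h : E =>
            actionMatrix μ T (check u) h * (actionMatrix μ T (check u) h)ᴴ) ∧
          max (√‖∑' h : E, (actionMatrix μ T (check u) h)ᴴ * actionMatrix μ T (check u) h‖)
              (√‖∑' h : E, actionMatrix μ T (check u) h * (actionMatrix μ T (check u) h)ᴴ‖)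
            ≤ ‖matrixOperator T‖)) ∧
    -- the row and column bound for an arbitrary subset of a discrete group
    (DiscreteTopology G → ∀ a : E →₀ (H →L[ℂ] H),
      max (√‖∑ h ∈ a.support, ContinuousLinearMap.adjoint (a h) * a h‖)
          (√‖∑ h ∈ a.support, a h * ContinuousLinearMap.adjoint (a h)‖)
        ≤ ‖∑ h ∈ a.support, TensorProduct.mapL (a h) (leftReg μ (h : G))‖) := by
  refine ⟨fun _ u hu n T hT => ?_, fun hG a => ?_⟩
  · obtain ⟨U, V, hV, hμV, ⟨-, hdisj⟩, hV1, -, hVU, hu⟩ := hu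
    have h0 : μ V ≠ 0 := (Measure.measure_pos_of_mem_nhds μ hV1).ne'
    have hVsub : V ⊆ U := fun x hx =>
      hVU (Set.mem_mul.2 ⟨x, hx, 1, mem_of_mem_nhds hV1, mul_one x⟩)
    have hE : Pairwise fun h k : E => Disjoint ((h : G) • V) ((k : G) • V) := fun h k hhk =>
      (hdisj h h.2 k k.2 (Subtype.coe_ne_coe.2 hhk)).mono
        (Set.smul_set_mono hVsub) (Set.smul_set_mono hVsub)
    have hcol := column_bound μ hV hμV h0 hE T hT hu
    refine ⟨hcol, fun hconj => ?_⟩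
    have hrow := row_bound μ hV hμV h0 hE T hT hu hconj
    exact ⟨hrow.1, max_le hcol.2 hrow.2⟩
  -- The singleton is open and compact, so its measure is positive and finite. Its translates by
  -- distinct points, or by their inverses, are disjoint.
  · have hV : MeasurableSet ({1} : Set G) := (isOpen_discrete _).measurableSet
    have hμV : μ ({1} : Set G) ≠ ∞ := isCompact_singleton.measure_ne_top
    have h0 : μ ({1} : Set G) ≠ 0 := (isOpen_discrete _).measure_ne_zero μ (Set.singleton_nonempty 1)
    refine row_column_le_norm_sum_mapL a.support a (fun h : E => leftReg μ (h : G))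
      (norm_normalizedIndicator μ hV hμV h0)
      (orthonormal_leftReg μ hV hμV h0 (fun h : E => (h : G)) fun h k hhk => ?_) ?_
    · simpa using fun hk => hhk (Subtype.ext hk)
    · simp only [adjoint_leftReg]
      refine orthonormal_leftReg μ hV hμV h0 (fun h : E => (h : G)⁻¹) fun h k hhk => ?_
      simpa using fun hk => hhk (Subtype.ext hk)
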